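/- Let $1<p<2$, let $\ell_p$ be the real Banach space of $p$-summable real sequences, let $\mathfrak F$ be a free filter on $\mathbb N$ (a proper filter containing all cofinite subsets of $\mathbb N$), and let $(a_n)_{n\in\mathbb N}$ be a sequence of positive reals. Call $I\subseteq\mathbb N$ $\mathfrak F$-stationary if $I\cap A\neq\emptyset$ for every $A\in\mathfrak F$. Let $\mathcal A(w^*,\ell_p^*,\mathfrak F)$ be the set of all sequences $(b_n)_{n\in\mathbb N}$ of positive reals for which there are functionals $x_n^*\in\ell_p^*$ with $\|x_n^*\|=b_n$ for all $n$ and $\lim_{\mathfrak F}x_n^*(x)=0$ for every $x\in\ell_p$. (1) If $\sum_{n\in I}a_n^{-p}=\infty$ for every $\mathfrak F$-stationary set $I$, then $(a_n)_{n\in\mathbb N}\in\mathcal A(w^*,\ell_p^*,\mathfrak F)$. (2) If $(a_n)_{n\in\mathbb N}\in\mathcal A(w^*,\ell_p^*,\mathfrak F)$, then $\sum_{n\in I}a_n^{-s}=\infty$ for every $1<s<p$ and every $\mathfrak F$-stationary set $I$. -/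

import Mathlib

/-- A set `I` of natural numbers is stationary with respect to the filter `F` if it has nonempty
intersection with each member of `F`. -/
def IsFilterStationary (F : Filter ℕ) (I : Set ℕ) : Prop :=
  ∀ A ∈ F, (I ∩ A).Nonempty

/-- The collection of all `(w*, E*, F)`-acceptable sequences: the sequences of positive reals that
are the sequences of norms `‖f n‖` of functionals `f n` in the dual of `E` whose limit along `F`
in the `w*` topology is zero. -/
def WeakStarAcceptable (E : Type*) [NormedAddCommGroup E] [NormedSpace ℝ E] (F : Filter ℕ) :
    Set (ℕ → ℝ) :=
  {a | (∀ n, 0 < a n) ∧ ∃ f : ℕ → StrongDual ℝ E,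
    (∀ n, ‖f n‖ = a n) ∧ ∀ x : E, Filter.Tendsto (fun n => f n x) F (nhds 0)}

/-! (1) Take `a n` times the `n`-th coordinate functional. If `a n * ‖x n‖ ≥ ε` on a stationary set,
then `∑ a n ^ (-p)` over that set is at most `ε ^ (-p) * ‖x‖ ^ p`, a contradiction.

(2) Suppose `∑ ‖f n‖ ^ (-s)` is finite over a stationary `I`. Scale almost norming vectors `u n` to
`v n = ‖f n‖ ^ (-s / p) • u n`. Their norms are `p`-summable, so by type `p` the random series `S =
∑ θ n • v n` converges a.s. along a subsequence. Each `θ n` has density at most 1, so `|f n (S)| <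
ε` has probability at most a multiple of `ε * ‖f n‖ ^ (-(1 - s / p))`. With `k` independent copies
of `S` this bound is raised to the power `k`. For large `k` and small `ε` the sum over `I` is below
1, so some finite set `y` satisfies `max_j |f n (y j)| ≥ ε` for all `n ∈ I`
(`exists_finite_norming_set`). This contradicts weak* convergence along `F`. -/

open MeasureTheory ProbabilityTheory in
/-- Independent random variables, each uniformly distributed on `[-1/2, 1/2]`. -/
structure IsUniformSequence {Ω : Type*} [MeasurableSpace Ω] (μ : Measure Ω) (θ : ℕ → Ω → ℝ) :
    Prop where
  measurable : ∀ n, Measurable (θ n)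
  indep : iIndepFun θ μ
  map_eq : ∀ n, μ.map (θ n) = (volume : Measure ℝ).restrict (Set.Icc (-1 / 2) (1 / 2))

/-! ### Moments and small-ball estimates for sums with uniform coefficients. -/

section Uniform

open MeasureTheory ProbabilityTheory Filter Topology
open scoped ENNReal

theorem exists_isUniformSequence :
    ∃ (μ : Measure (ℕ → ℝ)) (θ : ℕ → (ℕ → ℝ) → ℝ),
      IsProbabilityMeasure μ ∧ IsUniformSequence μ θ := by
  have hν : IsProbabilityMeasure ((volume : Measure ℝ).restrict (Set.Icc (-1 / 2) (1 / 2))) :=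
    ⟨by simp; norm_num⟩
  refine ⟨Measure.infinitePi fun _ => (volume : Measure ℝ).restrict (Set.Icc (-1 / 2) (1 / 2)),
    fun n ω => ω n, inferInstance, fun n => measurable_pi_apply n, ?_, fun n => ?_⟩
  · exact iIndepFun_infinitePi (X := fun _ x => x) (fun _ => measurable_id)
  · exact Measure.infinitePi_map_eval _ n

variable {Ω : Type*} [MeasurableSpace Ω] {μ : Measure Ω}
  {θ : ℕ → Ω → ℝ}

theorem IsUniformSequence.ae_abs_le (h : IsUniformSequence μ θ) (n : ℕ) :
    ∀ᵐ ω ∂μ, |θ n ω| ≤ 1 := by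
  have : ∀ᵐ x ∂(μ.map (θ n)), |x| ≤ 1 := by
    rw [h.map_eq]
    filter_upwards [ae_restrict_mem measurableSet_Icc] with x hx
    rw [abs_le]
    constructor <;> linarith [hx.1, hx.2]
  exact ae_of_ae_map (h.measurable n).aemeasurable this

theorem IsUniformSequence.integral_eq_zero (h : IsUniformSequence μ θ) (n : ℕ) :
    ∫ ω, θ n ω ∂μ = 0 := by
  have : ∫ ω, θ n ω ∂μ = ∫ x, x ∂(μ.map (θ n)) :=
    (integral_map (h.measurable n).aemeasurable aestronglyMeasurable_id).symm
  rw [this, h.map_eq, integral_Icc_eq_integral_Ioc, ← intervalIntegral.integral_of_le (by norm_num),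
    integral_id]
  norm_num

variable [IsProbabilityMeasure μ]

theorem IsUniformSequence.memLp (h : IsUniformSequence μ θ) (n : ℕ) (c : ℝ) :
    MemLp (fun ω => c * θ n ω) 2 μ :=
  MemLp.const_mul (MemLp.of_bound (h.measurable n).aestronglyMeasurable 1 (h.ae_abs_le n)) c

theorem IsUniformSequence.integral_sum_sq_le (h : IsUniformSequence μ θ) (T : Finset ℕ)
    (c : ℕ → ℝ) : ∫ ω, (∑ n ∈ T, c n * θ n ω) ^ 2 ∂μ ≤ ∑ n ∈ T, c n ^ 2 := by
  have hmean : ∀ n, ∫ ω, c n * θ n ω ∂μ = 0 := fun n => by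
    rw [integral_const_mul, h.integral_eq_zero, mul_zero]
  have hvar : ∀ n, variance (fun ω => c n * θ n ω) μ ≤ c n ^ 2 := fun n => by
    rw [variance_of_integral_eq_zero ((h.memLp n _).aestronglyMeasurable.aemeasurable) (hmean n)]
    calc ∫ ω, (c n * θ n ω) ^ 2 ∂μ ≤ ∫ _, c n ^ 2 ∂μ := by
          refine integral_mono_ae (h.memLp n _).integrable_sq (integrable_const _) ?_
          filter_upwards [h.ae_abs_le n] with ω hω
          have : θ n ω ^ 2 ≤ 1 := (sq_le_one_iff_abs_le_one _).2 hω
          simp only [mul_pow]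
          nlinarith [sq_nonneg (c n)]
      _ = c n ^ 2 := by simp
  have hsum : ∫ ω, (∑ n ∈ T, fun ω => c n * θ n ω) ω ∂μ = 0 := by
    simp only [Finset.sum_apply]
    rw [integral_finsetSum _ fun n _ => (h.memLp n _).integrable (by norm_num)]
    exact Finset.sum_eq_zero fun n _ => hmean n
  have hm : AEMeasurable (∑ n ∈ T, fun ω => c n * θ n ω) μ := by
    have := h.measurable
    fun_prop
  have key : variance (∑ n ∈ T, fun ω => c n * θ n ω) μ
      = ∑ n ∈ T, variance (fun ω => c n * θ n ω) μ := by
    refine IndepFun.variance_sum (fun n _ => h.memLp n _) fun i _ j _ hij => ?_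
    exact (h.indep.indepFun hij).comp (measurable_const_mul (c i)) (measurable_const_mul (c j))
  rw [variance_of_integral_eq_zero hm hsum] at key
  simp only [Finset.sum_apply] at key
  rw [key]
  exact Finset.sum_le_sum fun n _ => hvar n

/-- With the other terms fixed, `θ m` must fall in an interval of length `2 * ε / |c m|`, and its
density is at most 1. Random signs would not give this bound. -/
theorem IsUniformSequence.measure_abs_add_lt_le (h : IsUniformSequence μ θ) (T : Finset ℕ)
    (c : ℕ → ℝ) {m : ℕ} (hm : m ∈ T) (hc : c m ≠ 0) (ε : ℝ) :
    μ {ω | |∑ n ∈ T, c n * θ n ω| < ε} ≤ ENNReal.ofReal (2 * ε / |c m|) := by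
  classical
  have hmeas := h.measurable
  set X : Ω → ℝ := ∑ n ∈ T.erase m, fun ω => c n * θ n ω with hX
  have hXm : Measurable X := by fun_prop
  have hind : IndepFun X (fun ω => c m * θ m ω) μ := by
    refine iIndepFun.indepFun_finsetSum_of_notMem (f := fun n ω => c n * θ n ω) ?_
      (fun n => by fun_prop) (Finset.notMem_erase m T)
    exact h.indep.comp (fun n x => c n * x) fun n => measurable_const_mul (c n)
  have hind' : IndepFun X (θ m) μ := by
    have e : θ m = (fun x => (c m)⁻¹ * x) ∘ fun ω => c m * θ m ω :=
      funext fun ω => (inv_mul_cancel_left₀ hc _).symm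
    rw [e]
    exact hind.comp measurable_id (measurable_const_mul (c m)⁻¹)
  have hset : {ω | |∑ n ∈ T, c n * θ n ω| < ε}
      = (fun ω => (X ω, θ m ω)) ⁻¹' {q : ℝ × ℝ | |q.1 + c m * q.2| < ε} := by
    ext ω
    simp only [Set.mem_ofPred_eq, Set.mem_preimage, hX, Finset.sum_apply]
    rw [Finset.sum_erase_add _ _ hm]
  have hS : MeasurableSet {q : ℝ × ℝ | |q.1 + c m * q.2| < ε} :=
    measurableSet_lt (by fun_prop) measurable_const
  rw [hset, ← Measure.map_apply (hXm.prodMk (hmeas m)) hS,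
    (indepFun_iff_map_prod_eq_prod_map_map hXm.aemeasurable (hmeas m).aemeasurable).1 hind']
  have : IsProbabilityMeasure (μ.map X) := Measure.isProbabilityMeasure_map hXm.aemeasurable
  have : IsProbabilityMeasure (μ.map (θ m)) :=
    Measure.isProbabilityMeasure_map (hmeas m).aemeasurable
  rw [Measure.prod_apply hS]
  calc ∫⁻ x, μ.map (θ m) (Prod.mk x ⁻¹' {q : ℝ × ℝ | |q.1 + c m * q.2| < ε}) ∂(μ.map X)
      ≤ ∫⁻ _, ENNReal.ofReal (2 * ε / |c m|) ∂(μ.map X) := by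
        refine lintegral_mono fun x => ?_
        rw [h.map_eq]
        refine (Measure.restrict_apply_le _ _).trans ?_
        have hball : (Prod.mk x ⁻¹' {q : ℝ × ℝ | |q.1 + c m * q.2| < ε})
            ⊆ Metric.ball (-x / c m) (ε / |c m|) := by
          intro y hy
          simp only [Set.mem_preimage, Set.mem_ofPred_eq] at hy
          rw [Metric.mem_ball, Real.dist_eq, lt_div_iff₀ (abs_pos.2 hc), ← abs_mul]
          have : (y - -x / c m) * c m = x + c m * y := by
            field_simp
            ring
          rwa [this]
        refine (measure_mono hball).trans ?_
        rw [Real.volume_ball, mul_div_assoc]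
    _ = ENNReal.ofReal (2 * ε / |c m|) := by simp

theorem ENNReal.rpow_sum_sq_le {ι : Type*} (T : Finset ι) (x : ι → ℝ≥0∞) {p : ℝ} (hp0 : 0 < p)
    (hp2 : p ≤ 2) : (∑ n ∈ T, x n ^ (2 : ℝ)) ^ (p / 2) ≤ ∑ n ∈ T, x n ^ p := by
  classical
  have := Finset.le_sum_of_subadditive (fun y : ℝ≥0∞ => y ^ (p / 2))
    (by simp [hp0])
    (fun y z => ENNReal.rpow_add_le_add_rpow y z (by positivity) (by linarith)) T
    (fun n => x n ^ (2 : ℝ))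
  refine this.trans_eq (Finset.sum_congr rfl fun n _ => ?_)
  rw [← ENNReal.rpow_mul]
  congr 1
  ring

/-- Orthogonality bounds the second moment, monotonicity of `L^q` norms passes to exponent `p`, and
subadditivity of `t ^ (p / 2)` splits the sum. -/
theorem IsUniformSequence.lintegral_sum_rpow_le (h : IsUniformSequence μ θ) (T : Finset ℕ)
    (c : ℕ → ℝ) {p : ℝ} (hp0 : 0 < p) (hp2 : p ≤ 2) :
    ∫⁻ ω, ‖∑ n ∈ T, c n * θ n ω‖ₑ ^ p ∂μ ≤ ∑ n ∈ T, ‖c n‖ₑ ^ p := by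
  have hmeas := h.measurable
  have h2 : ∫⁻ ω, ‖∑ n ∈ T, c n * θ n ω‖ₑ ^ (2 : ℝ) ∂μ ≤ ∑ n ∈ T, ‖c n‖ₑ ^ (2 : ℝ) := by
    have e : ∀ x : ℝ, ‖x‖ₑ ^ (2 : ℝ) = ENNReal.ofReal (x ^ 2) := fun x => by
      rw [Real.enorm_eq_ofReal_abs, ENNReal.rpow_two, ← ENNReal.ofReal_pow (abs_nonneg _), sq_abs]
    simp only [e]
    rw [← ENNReal.ofReal_sum_of_nonneg fun _ _ => sq_nonneg _,
      ← ofReal_integral_eq_lintegral_ofReal _ (ae_of_all _ fun _ => sq_nonneg _)]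
    · exact ENNReal.ofReal_le_ofReal (h.integral_sum_sq_le T c)
    · exact (memLp_finsetSum T fun n _ => h.memLp n (c n)).integrable_sq
  have hJ := eLpNorm'_le_eLpNorm'_of_exponent_le (μ := μ) hp0 hp2
    (f := fun ω => ∑ n ∈ T, c n * θ n ω)
    (by fun_prop : Measurable fun ω => ∑ n ∈ T, c n * θ n ω).aestronglyMeasurable
  rw [eLpNorm', eLpNorm', one_div, ENNReal.rpow_inv_le_iff hp0, ← ENNReal.rpow_mul] at hJ
  refine hJ.trans ?_
  rw [show 1 / 2 * p = p / 2 by ring]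
  exact (ENNReal.rpow_le_rpow h2 (by positivity)).trans (ENNReal.rpow_sum_sq_le T _ hp0 hp2)

theorem lp_enorm_rpow_eq_tsum {p : ℝ} [Fact (1 ≤ ENNReal.ofReal p)] (hp : 0 < p)
    (x : lp (fun _ : ℕ => ℝ) (ENNReal.ofReal p)) : ‖x‖ₑ ^ p = ∑' i, ‖x i‖ₑ ^ p := by
  have hr : (ENNReal.ofReal p).toReal = p := ENNReal.toReal_ofReal hp.le
  have hs := lp.hasSum_norm (by rw [hr]; exact hp) x
  rw [hr] at hs
  rw [← ofReal_norm, ENNReal.ofReal_rpow_of_nonneg (norm_nonneg x) hp.le, ← hs.tsum_eq,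
    ENNReal.ofReal_tsum_of_nonneg (fun i => by positivity) hs.summable]
  refine tsum_congr fun i => ?_
  rw [← ofReal_norm, ENNReal.ofReal_rpow_of_nonneg (norm_nonneg _) hp.le]

variable {p : ℝ} [Fact (1 ≤ ENNReal.ofReal p)]

/-- The space `ℓ_p` has type `p` with constant `1` along a uniform sequence. -/
theorem IsUniformSequence.lintegral_lp_sum_rpow_le (h : IsUniformSequence μ θ) (T : Finset ℕ)
    (v : ℕ → lp (fun _ : ℕ => ℝ) (ENNReal.ofReal p)) (hp0 : 0 < p) (hp2 : p ≤ 2) :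
    ∫⁻ ω, ‖∑ n ∈ T, θ n ω • v n‖ₑ ^ p ∂μ ≤ ∑ n ∈ T, ‖v n‖ₑ ^ p := by
  have hmeas := h.measurable
  have e : ∀ ω i, (∑ n ∈ T, θ n ω • v n : lp (fun _ : ℕ => ℝ) (ENNReal.ofReal p)) i
      = ∑ n ∈ T, v n i * θ n ω := fun ω i => by
    rw [lp.coeFn_sum, Finset.sum_apply]
    exact Finset.sum_congr rfl fun n _ => mul_comm _ _
  simp only [lp_enorm_rpow_eq_tsum hp0, e]
  -- The `p`-th power of the norm is a sum over coordinates, so the scalar estimate applies to each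
  -- one.
  rw [lintegral_tsum fun i => by fun_prop]
  refine (ENNReal.tsum_le_tsum fun i => h.lintegral_sum_rpow_le T (fun n => v n i) hp0 hp2).trans ?_
  exact (Summable.tsum_finsetSum fun _ _ => ENNReal.summable).le

end Uniform

/-! ### The random series and its independent copies. -/

section Limit

open MeasureTheory ProbabilityTheory Filter Topology
open scoped ENNReal

variable {Ω : Type*} [MeasurableSpace Ω] {μ : Measure Ω} [IsProbabilityMeasure μ]
  {θ : ℕ → Ω → ℝ} {p : ℝ} [Fact (1 ≤ ENNReal.ofReal p)]

/-- Type `p` makes the partial sums Cauchy in `L^p`. A subsequence with geometric rate converges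
a.e., which is all that is needed later. -/
theorem IsUniformSequence.exists_ae_tendsto (h : IsUniformSequence μ θ)
    (v : ℕ → lp (fun _ : ℕ => ℝ) (ENNReal.ofReal p)) (hp1 : 1 ≤ p) (hp2 : p ≤ 2)
    (hv : ∑' n, ‖v n‖ₑ ^ p ≠ ∞) :
    ∃ (S : Ω → lp (fun _ : ℕ => ℝ) (ENNReal.ofReal p)) (N : ℕ → ℕ), StrictMono N ∧
      ∀ᵐ ω ∂μ, Tendsto (fun k => ∑ n ∈ Finset.range (N k), θ n ω • v n) atTop (𝓝 (S ω)) := by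
  classical
  have hmeas := h.measurable
  have hp0 : 0 < p := by linarith
  have htail : Tendsto (fun n => ∑' b : {x // x ∉ Finset.range n}, ‖v b‖ₑ ^ p) atTop (𝓝 0) :=
    (ENNReal.tendsto_tsum_compl_atTop_zero hv).comp tendsto_finset_range
  have hB : ∀ k : ℕ, (0 : ℝ≥0∞) < ((2⁻¹ : ℝ≥0∞) ^ k) ^ p := fun k =>
    ENNReal.rpow_pos (ENNReal.pow_pos (by simp) k) (ENNReal.pow_ne_top (by simp))
  obtain ⟨N, hN, hNB⟩ := extraction_forall_of_eventually fun k =>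
    htail.eventually (gt_mem_nhds (hB k))
  set f : ℕ → Ω → lp (fun _ : ℕ => ℝ) (ENNReal.ofReal p) :=
    fun k ω => ∑ n ∈ Finset.range (N k), θ n ω • v n with hf
  have hfm : ∀ k, AEStronglyMeasurable (f k) μ := fun k => by
    refine Finset.aestronglyMeasurable_fun_sum _ fun n _ => ?_
    exact (hmeas n).aestronglyMeasurable.smul_const (v n)
  have hdiff : ∀ k n m : ℕ, k ≤ m → m ≤ n →
      eLpNorm (f n - f m) (ENNReal.ofReal p) μ < 2⁻¹ ^ k := by
    intro k n m hkm hmn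
    rw [eLpNorm_eq_lintegral_rpow_enorm_toReal (by simpa using hp0) ENNReal.ofReal_ne_top,
      ENNReal.toReal_ofReal hp0.le, one_div, ENNReal.rpow_inv_lt_iff hp0]
    have hsub : Finset.range (N m) ⊆ Finset.range (N n) :=
      Finset.range_subset_range.2 (hN.monotone hmn)
    have e : ∀ ω, (f n - f m) ω
        = ∑ j ∈ Finset.range (N n) \ Finset.range (N m), θ j ω • v j := fun ω => by
      rw [Pi.sub_apply, Finset.sum_sdiff_eq_sub hsub]
    simp only [e]
    refine ((h.lintegral_lp_sum_rpow_le _ v hp0 hp2).trans ?_).trans_lt (hNB k)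
    have hmem : ∀ j ∈ Finset.range (N n) \ Finset.range (N m), j ∉ Finset.range (N k) := by
      intro j hj
      have := hN.monotone hkm
      simp only [Finset.mem_sdiff, Finset.mem_range] at hj ⊢
      omega
    rw [← Finset.sum_subtype_of_mem (p := fun j => j ∉ Finset.range (N k))
      (fun j => ‖v j‖ₑ ^ p) hmem]
    exact ENNReal.sum_le_tsum _
  have hlim := Lp.ae_tendsto_of_cauchy_eLpNorm (p := ENNReal.ofReal p) hfm Fact.out
    (B := fun k => (2⁻¹ : ℝ≥0∞) ^ k) (by simp [ENNReal.tsum_geometric]) (by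
      intro k n m hn hm
      rcases le_total m n with hmn | hmn
      · exact hdiff k n m hm hmn
      · rw [eLpNorm_sub_comm]
        exact hdiff k m n hn hmn)
  -- The limit is set to `0` wherever the subsequence diverges.
  have hch : ∀ ω, ∃ l, (∃ l, Tendsto (fun k => f k ω) atTop (𝓝 l)) →
      Tendsto (fun k => f k ω) atTop (𝓝 l) := fun ω => by
    by_cases hω : ∃ l, Tendsto (fun k => f k ω) atTop (𝓝 l)
    · exact hω.imp fun l hl _ => hl
    · exact ⟨0, fun hc => absurd hc hω⟩
  choose S hS using hch
  exact ⟨S, N, hN, hlim.mono fun ω hω => hS ω hω⟩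

/-- The small-ball bound does not depend on the number of terms, so it survives the limit: the event
for `S` lies a.e. in the liminf of the events for partial sums. -/
theorem IsUniformSequence.measure_limit_lt_le (h : IsUniformSequence μ θ)
    {E : Type*} [NormedAddCommGroup E] [NormedSpace ℝ E] {v : ℕ → E} {S : Ω → E} {N : ℕ → ℕ}
    (hN : StrictMono N)
    (hS : ∀ᵐ ω ∂μ, Tendsto (fun k => ∑ n ∈ Finset.range (N k), θ n ω • v n) atTop (𝓝 (S ω)))
    (φ : StrongDual ℝ E) {m : ℕ} (hm : φ (v m) ≠ 0) (ε : ℝ) :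
    μ {ω | |φ (S ω)| < ε} ≤ ENNReal.ofReal (2 * ε / |φ (v m)|) := by
  set A : ℕ → Set Ω := fun k => {ω | |∑ n ∈ Finset.range (N k), φ (v n) * θ n ω| < ε} with hA
  have hsub : {ω | |φ (S ω)| < ε} ≤ᵐ[μ] ⋃ K, ⋂ k ≥ K, A k := by
    filter_upwards [hS] with ω hω hlt
    have ht := ((φ.continuous.tendsto _).comp hω).abs
    have hev := ht.eventually (gt_mem_nhds hlt)
    obtain ⟨K, hK⟩ := eventually_atTop.1 hev
    refine Set.mem_iUnion.2 ⟨K, Set.mem_iInter₂.2 fun k hk => ?_⟩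
    have := hK k hk
    simpa [hA, map_sum, mul_comm] using this
  refine (measure_mono_ae hsub).trans ?_
  have hmono : Monotone fun K => ⋂ k ≥ K, A k := fun K L hKL =>
    Set.iInter₂_mono' fun k hk => ⟨k, hKL.trans hk, subset_rfl⟩
  rw [hmono.measure_iUnion]
  refine iSup_le fun K => ?_
  -- An index of at least `m + 1` guarantees that the partial sum contains the term `m`.
  have hin : (⋂ k ≥ K, A k) ⊆ A (max K (m + 1)) := Set.iInter₂_subset _ (le_max_left _ _)
  refine (measure_mono hin).trans (h.measure_abs_add_lt_le _ (fun n => φ (v n)) ?_ hm ε)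
  have := hN.id_le (max K (m + 1))
  have := le_max_right K (m + 1)
  simp only [id_eq, Finset.mem_range] at *
  omega

/-- If each of the events `{|f n (S)| < ε}` has small probability, then finitely many independent
copies of `S` produce vectors with `max_j |f n (y j)| ≥ ε` for all `n ∈ I` at once. -/
theorem exists_forall_exists_le_abs {E : Type*} {S : Ω → E} {g : ℕ → E → ℝ} {I : Set ℕ} {ε : ℝ}
    {k : ℕ} (hsum : ∑' n : I, μ {ω | |g n (S ω)| < ε} ^ k < 1) :
    ∃ y : Fin k → E, ∀ n ∈ I, ∃ j, ε ≤ |g n (y j)| := by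
  set P : Measure (Fin k → Ω) := Measure.pi fun _ => μ
  have hU : P (⋃ n : I, Set.univ.pi fun _ => {ω | |g n (S ω)| < ε}) < 1 := by
    refine (measure_iUnion_le _).trans_lt (lt_of_le_of_lt (le_of_eq ?_) hsum)
    refine tsum_congr fun n => ?_
    rw [Measure.pi_pi]
    simp
  have : (⋃ n : I, Set.univ.pi fun _ : Fin k => {ω | |g n (S ω)| < ε}) ≠ Set.univ := fun hc => by
    rw [hc, measure_univ] at hU
    exact lt_irrefl _ hU
  obtain ⟨ω, hω⟩ := (Set.ne_univ_iff_exists_notMem _).1 this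
  refine ⟨fun j => S (ω j), fun n hn => ?_⟩
  by_contra! hc
  exact hω (Set.mem_iUnion.2 ⟨⟨n, hn⟩, fun j _ => hc j⟩)

end Limit

/-! ### The two implications. -/

section Acceptable

open MeasureTheory ProbabilityTheory Filter Topology
open scoped ENNReal

variable {p : ℝ} [Fact (1 ≤ ENNReal.ofReal p)]

theorem lp_norm_evalCLM (i : ℕ) :
    ‖lp.evalCLM ℝ (fun _ : ℕ => ℝ) (ENNReal.ofReal p) i‖ = 1 := by
  have hp : ENNReal.ofReal p ≠ 0 := (zero_lt_one.trans_le Fact.out).ne'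
  refine le_antisymm (ContinuousLinearMap.opNorm_le_bound _ zero_le_one fun x => ?_) ?_
  · rw [one_mul]
    exact lp.norm_apply_le_norm hp x i
  · have h := (lp.evalCLM ℝ (fun _ : ℕ => ℝ) (ENNReal.ofReal p) i).le_opNorm
      (lp.single (E := fun _ : ℕ => ℝ) (ENNReal.ofReal p) i 1)
    rw [lp.norm_single (pos_iff_ne_zero.2 hp), norm_one, mul_one] at h
    refine le_trans (le_of_eq ?_) h
    change 1 = ‖lp.single (E := fun _ : ℕ => ℝ) (ENNReal.ofReal p) i 1 i‖
    simp

theorem mem_weakStarAcceptable_of_tsum_eq_top (hp0 : 0 < p) {F : Filter ℕ} {a : ℕ → ℝ}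
    (ha : ∀ n, 0 < a n)
    (h : ∀ I : Set ℕ, IsFilterStationary F I → ∑' n : I, ENNReal.ofReal (a n ^ (-p)) = ∞) :
    a ∈ WeakStarAcceptable (lp (fun _ : ℕ => ℝ) (ENNReal.ofReal p)) F := by
  refine ⟨ha, fun n => a n • lp.evalCLM ℝ (fun _ : ℕ => ℝ) (ENNReal.ofReal p) n, fun n => ?_,
    fun x => ?_⟩
  · rw [norm_smul, lp_norm_evalCLM, mul_one, Real.norm_of_nonneg (ha n).le]
  rw [Metric.tendsto_nhds]
  intro ε hε
  change ∀ᶠ n in F, dist (a n * x n) 0 < ε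
  simp only [dist_zero_right, norm_mul, Real.norm_of_nonneg (ha _).le]
  by_contra hcon
  have hI : IsFilterStationary F {n | ε ≤ a n * ‖x n‖} := fun A hA => by
    by_contra hne
    refine hcon (mem_of_superset hA fun n hn => ?_)
    by_contra hlt
    exact hne ⟨n, (not_lt.1 hlt : ε ≤ a n * ‖x n‖), hn⟩
  have hle : ∑' n : {n | ε ≤ a n * ‖x n‖}, ENNReal.ofReal (a n ^ (-p))
      ≤ ENNReal.ofReal (ε ^ (-p)) * ‖x‖ₑ ^ p := by
    rw [lp_enorm_rpow_eq_tsum hp0, ← ENNReal.tsum_mul_left]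
    refine (ENNReal.tsum_le_tsum fun n => ?_).trans (ENNReal.tsum_comp_le_tsum_of_injective
      Subtype.val_injective fun n => ENNReal.ofReal (ε ^ (-p)) * ‖x n‖ₑ ^ p)
    have hn : ε ≤ a n * ‖x n‖ := n.2
    rw [← ofReal_norm, ENNReal.ofReal_rpow_of_nonneg (norm_nonneg _) hp0.le,
      ← ENNReal.ofReal_mul (by positivity)]
    refine ENNReal.ofReal_le_ofReal ?_
    have := Real.rpow_le_rpow hε.le hn hp0.le
    rw [Real.mul_rpow (ha n).le (norm_nonneg _)] at this
    have h1 : 0 < a n ^ p := Real.rpow_pos_of_pos (ha n) p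
    have h2 : 0 < ε ^ p := Real.rpow_pos_of_pos hε p
    rw [Real.rpow_neg (ha n).le, Real.rpow_neg hε.le, inv_mul_eq_div, inv_eq_one_div,
      div_le_div_iff₀ h1 h2]
    linarith
  rw [h _ hI, top_le_iff] at hle
  exact ENNReal.mul_ne_top ENNReal.ofReal_ne_top
    (ENNReal.rpow_ne_top_of_nonneg hp0.le enorm_ne_top) hle

/-- If the norms of the functionals `f n` grow so fast that `∑ ‖f n‖ ^ (-s) < ∞` over `I`, then
the functionals `f n`, `n ∈ I`, are uniformly bounded away from zero on some finite set. -/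
theorem exists_finite_norming_set (hp1 : 1 ≤ p) (hp2 : p ≤ 2)
    {f : ℕ → StrongDual ℝ (lp (fun _ : ℕ => ℝ) (ENNReal.ofReal p))} (hf : ∀ n, 0 < ‖f n‖)
    {s : ℝ} (hs0 : 0 < s) (hsp : s < p) {I : Set ℕ}
    (hI : ∑' n : I, ENNReal.ofReal (‖f n‖ ^ (-s)) ≠ ∞) :
    ∃ ε > 0, ∃ (k : ℕ) (y : Fin k → lp (fun _ : ℕ => ℝ) (ENNReal.ofReal p)),
      ∀ n ∈ I, ∃ j, ε ≤ |f n (y j)| := by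
  classical
  have hp0 : 0 < p := by linarith
  have hu : ∀ n, ∃ u, ‖u‖ ≤ 1 ∧ ‖f n‖ / 2 ≤ |f n u| := fun n => by
    obtain ⟨u, hu1, hu2⟩ := (f n).exists_lt_apply_of_lt_opNorm (half_lt_self (hf n))
    exact ⟨u, hu1.le, hu2.le⟩
  choose u hu1 hu2 using hu
  set z : ℕ → ℝ≥0∞ := fun n => ENNReal.ofReal (‖f n‖ ^ (-s)) with hz
  set M := ∑' n : I, z n with hM
  -- The weight gives `‖v n‖ ^ p ≤ ‖f n‖ ^ (-s)` on `I`, while `|f n (v n)|` still grows like `‖f n‖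
  -- ^ (1 - s / p)`.
  set v : ℕ → lp (fun _ : ℕ => ℝ) (ENNReal.ofReal p) :=
    I.indicator fun n => ‖f n‖ ^ (-s / p) • u n with hv
  have hvsum : ∑' n, ‖v n‖ₑ ^ p ≠ ∞ := by
    refine ne_top_of_le_ne_top hI ?_
    rw [hM, tsum_subtype I z]
    refine ENNReal.tsum_le_tsum fun n => ?_
    by_cases hn : n ∈ I
    · rw [hv, Set.indicator_of_mem hn, Set.indicator_of_mem hn, ← ofReal_norm,
        ENNReal.ofReal_rpow_of_nonneg (norm_nonneg _) hp0.le]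
      refine ENNReal.ofReal_le_ofReal ?_
      have hw : 0 ≤ ‖f n‖ ^ (-s / p) := by positivity
      have : ‖‖f n‖ ^ (-s / p) • u n‖ ≤ ‖f n‖ ^ (-s / p) := by
        rw [norm_smul, Real.norm_of_nonneg hw]
        exact mul_le_of_le_one_right hw (hu1 n)
      refine (Real.rpow_le_rpow (norm_nonneg _) this hp0.le).trans_eq ?_
      rw [← Real.rpow_mul (norm_nonneg _), div_mul_cancel₀ _ hp0.ne']
    · simp [hv, hn, hp0]
  obtain ⟨μ, θ, hμ, hθ⟩ := exists_isUniformSequence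
  obtain ⟨S, N, hN, hS⟩ := hθ.exists_ae_tendsto v hp1 hp2 hvsum
  -- Chosen so that `z n ^ r` is `‖f n‖ ^ (-(1 - s / p))`.
  set r : ℝ := (1 - s / p) / s with hr
  have hr0 : 0 < r := div_pos (by rw [sub_pos, div_lt_one hp0]; exact hsp) hs0
  have hprob : ∀ n ∈ I, ∀ ε : ℝ, 0 ≤ ε →
      μ {ω | |f n (S ω)| < ε} ≤ ENNReal.ofReal (4 * ε) * z n ^ r := by
    intro n hn ε hε
    have hlow : ‖f n‖ ^ (1 - s / p) / 2 ≤ |f n (v n)| := by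
      have hw : 0 ≤ ‖f n‖ ^ (-s / p) := by positivity
      rw [hv, Set.indicator_of_mem hn, map_smul, smul_eq_mul, abs_mul, abs_of_nonneg hw,
        show 1 - s / p = -s / p + 1 by ring, Real.rpow_add (hf n), Real.rpow_one, mul_div_assoc]
      exact mul_le_mul_of_nonneg_left (hu2 n) hw
    have hpow : 0 < ‖f n‖ ^ (1 - s / p) := Real.rpow_pos_of_pos (hf n) _
    have hne : f n (v n) ≠ 0 := abs_pos.1 (by linarith)
    refine (hθ.measure_limit_lt_le hN hS (f n) hne ε).trans ?_
    rw [hz, ENNReal.ofReal_rpow_of_nonneg (by positivity) hr0.le,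
      ← ENNReal.ofReal_mul (by positivity), ← Real.rpow_mul (norm_nonneg _),
      show -s * r = -(1 - s / p) by rw [hr]; field_simp, Real.rpow_neg (norm_nonneg _)]
    refine ENNReal.ofReal_le_ofReal ?_
    calc 2 * ε / |f n (v n)| ≤ 2 * ε / (‖f n‖ ^ (1 - s / p) / 2) := by gcongr
      _ = 4 * ε * (‖f n‖ ^ (1 - s / p))⁻¹ := by field_simp; ring
  -- With `r * k ≥ 1`, `z n ^ (r * k)` is at most `M ^ (r * k - 1) * z n`, which is summable over
  -- `I`.
  obtain ⟨k, hk⟩ := exists_nat_ge (1 / r)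
  have hrk : 1 ≤ r * k := by rwa [div_le_iff₀' hr0] at hk
  have hk0 : k ≠ 0 := by
    rintro rfl
    norm_num at hrk
  have hC : M ^ (r * k - 1) * M ≠ ∞ :=
    ENNReal.mul_ne_top (ENNReal.rpow_ne_top_of_nonneg (by linarith) hI) hI
  obtain ⟨δ, hδ0, hδ⟩ := ENNReal.exists_nnreal_pos_mul_lt hC one_ne_zero
  -- The cap at 1 yields `δ' ^ k ≤ δ' ≤ δ`.
  set δ' : ℝ := min δ 1
  have hδ'0 : 0 < δ' := lt_min (by exact_mod_cast hδ0) one_pos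
  refine ⟨δ' / 4, by positivity, k,
    exists_forall_exists_le_abs (μ := μ) (S := S) (g := fun n x => f n x) ?_⟩
  refine lt_of_le_of_lt ?_ hδ
  have hpow : ENNReal.ofReal δ' ^ k ≤ δ := by
    have h1 : ENNReal.ofReal δ' ≤ 1 := ENNReal.ofReal_le_one.2 (min_le_right _ _)
    refine (pow_le_of_le_one zero_le h1 hk0).trans ?_
    exact (ENNReal.ofReal_le_ofReal (min_le_left _ _)).trans (by simp)
  calc ∑' n : I, μ {ω | |f n (S ω)| < δ' / 4} ^ k
      ≤ ∑' n : I, δ * M ^ (r * k - 1) * z n := by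
        refine ENNReal.tsum_le_tsum fun n => ?_
        have hzM : z n ≤ M := ENNReal.le_tsum (f := fun n : I => z n) n
        calc μ {ω | |f n (S ω)| < δ' / 4} ^ k
            ≤ (ENNReal.ofReal (4 * (δ' / 4)) * z n ^ r) ^ k :=
              pow_le_pow_left' (hprob n n.2 _ (by positivity)) k
          _ = ENNReal.ofReal δ' ^ k * z n ^ (r * k) := by
              rw [mul_pow, mul_div_cancel₀ _ (by norm_num : (4 : ℝ) ≠ 0), ENNReal.rpow_mul,
                ENNReal.rpow_natCast]
          _ = ENNReal.ofReal δ' ^ k * (z n ^ (r * k - 1) * z n) := by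
              conv_rhs => rw [← ENNReal.rpow_one (z n), ← ENNReal.rpow_mul, one_mul,
                ← ENNReal.rpow_add_of_nonneg _ _ (by linarith) zero_le_one, sub_add_cancel]
          _ ≤ δ * (M ^ (r * k - 1) * z n) := by
              gcongr
          _ = δ * M ^ (r * k - 1) * z n := (mul_assoc _ _ _).symm
    _ = δ * (M ^ (r * k - 1) * M) := by rw [ENNReal.tsum_mul_left, mul_assoc]

theorem tsum_eq_top_of_mem_weakStarAcceptable (hp1 : 1 ≤ p) (hp2 : p ≤ 2) {F : Filter ℕ}
    {a : ℕ → ℝ} (h : a ∈ WeakStarAcceptable (lp (fun _ : ℕ => ℝ) (ENNReal.ofReal p)) F) {s : ℝ}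
    (hs0 : 0 < s) (hsp : s < p) {I : Set ℕ} (hI : IsFilterStationary F I) :
    ∑' n : I, ENNReal.ofReal (a n ^ (-s)) = ∞ := by
  obtain ⟨ha, f, hfa, hf⟩ := h
  by_contra hfin
  simp only [← hfa] at ha hfin
  obtain ⟨ε, hε, k, y, hy⟩ := exists_finite_norming_set hp1 hp2 ha hs0 hsp hfin
  -- Finiteness of the set of vectors `y j` is essential here.
  have hA : ∀ᶠ n in F, ∀ j, |f n (y j)| < ε := eventually_all.2 fun j =>
    (by simpa using (hf (y j)).abs : Tendsto _ F (𝓝 (0 : ℝ))).eventually (gt_mem_nhds hε)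
  obtain ⟨n, hnI, hn⟩ := hI _ hA
  obtain ⟨j, hj⟩ := hy n hnI
  exact (hn j).not_ge hj

end Acceptable

theorem mainTheorem11 (p : ℝ) (hp1 : 1 < p) (hp2 : p < 2)
    [Fact (1 ≤ ENNReal.ofReal p)]
    (F : Filter ℕ) [F.NeBot] (hF : F ≤ Filter.cofinite)
    (a : ℕ → ℝ) (ha : ∀ n, 0 < a n) :
    ((∀ I : Set ℕ, IsFilterStationary F I → ∑' n : I, ENNReal.ofReal (a n ^ (-p)) = ⊤) →
      a ∈ WeakStarAcceptable (lp (fun _ : ℕ => ℝ) (ENNReal.ofReal p)) F) ∧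
    (a ∈ WeakStarAcceptable (lp (fun _ : ℕ => ℝ) (ENNReal.ofReal p)) F →
      ∀ s : ℝ, 1 < s → s < p → ∀ I : Set ℕ, IsFilterStationary F I →
        ∑' n : I, ENNReal.ofReal (a n ^ (-s)) = ⊤) :=
  ⟨mem_weakStarAcceptable_of_tsum_eq_top (by linarith) ha, fun h _ hs1 hsp _ hI =>
    tsum_eq_top_of_mem_weakStarAcceptable hp1.le hp2.le h (by linarith) hsp hI⟩
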